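/- All spaces are real. A Banach space $X$ has the metric approximation property (MAP) if there is a net $(S_\alpha)$ of bounded finite-rank operators $S_\alpha : X \to X$ with $\|S_\alpha\| \le 1$ for every $\alpha$ and $S_\alpha(x) \to x$ for every $x \in X$. The norm of a Banach space $Z$ is strongly subdifferentiable (SSD) if, for every $x$ in the unit sphere $S_Z$, the one-sided limit $\lim_{t \to 0^+} \frac{\|x + th\| - \|x\|}{t}$ exists uniformly for $h \in S_Z$. For normed spaces $X$ and $Y$, the projective tensor product $X \widehat{\otimes}_\pi Y$ is the completion of the algebraic tensor product $X \otimes Y$ for the norm $$\|z\|_\pi = \inf\Big\{ \sum_{i=1}^n \|x_i\|\,\|y_i\| : z = \sum_{i=1}^n x_i \otimes y_i \Big\}.$$ Let $X$ be an infinite-dimensional Banach space with the MAP, and let $X^*$ be its topological dual. For every infinite-dimensional linear subspace $Y$ of $X$ (closed or not), with the norm of $X$, the norm of $Y \widehat{\otimes}_\pi X^*$ is not SSD. In particular, the norm of $X \widehat{\otimes}_\pi X^*$ is not SSD. -/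

import Mathlib

open scoped TensorProduct Topology

namespace ProjTensor

/-- The algebraic tensor product `X ⊗ Y` of two real normed spaces, as a type of its own, which is
going to carry the projective norm. -/
def Alg (X Y : Type*) [NormedAddCommGroup X] [NormedSpace ℝ X]
    [NormedAddCommGroup Y] [NormedSpace ℝ Y] : Type _ := X ⊗[ℝ] Y

section

variable {X Y : Type*} [NormedAddCommGroup X] [NormedSpace ℝ X]
  [NormedAddCommGroup Y] [NormedSpace ℝ Y]

noncomputable instance : AddCommGroup (Alg X Y) := inferInstanceAs (AddCommGroup (X ⊗[ℝ] Y))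

noncomputable instance : Module ℝ (Alg X Y) := inferInstanceAs (Module ℝ (X ⊗[ℝ] Y))

/-- The elementary tensor `x ⊗ y`. -/
noncomputable def tmul (x : X) (y : Y) : Alg X Y := TensorProduct.tmul ℝ x y

theorem smul_tmul (a : ℝ) (x : X) (y : Y) : a • tmul x y = tmul (a • x) y := rfl

/-- The values `∑ i, ‖x i‖ * ‖y i‖` over all representations `z = ∑ i, x i ⊗ y i` with finitely
many summands. -/
def costs (z : Alg X Y) : Set ℝ :=
  {r | ∃ (n : ℕ) (x : Fin n → X) (y : Fin n → Y),
    z = ∑ i, tmul (x i) (y i) ∧ r = ∑ i, ‖x i‖ * ‖y i‖}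

/-- The projective norm. -/
noncomputable instance : Norm (Alg X Y) := ⟨fun z => sInf (costs z)⟩

theorem norm_def (z : Alg X Y) : ‖z‖ = sInf (costs z) := rfl

theorem costs_nonneg {z : Alg X Y} {r : ℝ} (hr : r ∈ costs z) : 0 ≤ r := by
  obtain ⟨n, x, y, -, rfl⟩ := hr
  positivity

theorem bddBelow_costs (z : Alg X Y) : BddBelow (costs z) := ⟨0, fun _ hr => costs_nonneg hr⟩

theorem costs_add {z w : Alg X Y} {r s : ℝ} (hr : r ∈ costs z) (hs : s ∈ costs w) :
    r + s ∈ costs (z + w) := by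
  obtain ⟨n, x, y, rfl, rfl⟩ := hr
  obtain ⟨m, x', y', rfl, rfl⟩ := hs
  exact ⟨n + m, Fin.append x x', Fin.append y y', by simp [Fin.sum_univ_add],
    by simp [Fin.sum_univ_add]⟩

theorem costs_smul {z : Alg X Y} {r : ℝ} (a : ℝ) (hr : r ∈ costs z) :
    ‖a‖ * r ∈ costs (a • z) := by
  obtain ⟨n, x, y, rfl, rfl⟩ := hr
  exact ⟨n, fun i => a • x i, y, by simp [Finset.smul_sum, smul_tmul],
    by simp [Finset.mul_sum, norm_smul, mul_assoc]⟩

theorem costs_nonempty (z : Alg X Y) : (costs z).Nonempty := by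
  refine TensorProduct.induction_on (motive := fun z => (costs (X := X) (Y := Y) z).Nonempty) z
    ?_ ?_ ?_
  · exact ⟨0, 0, Fin.elim0, Fin.elim0, by simp; rfl, by simp⟩
  · intro x y
    exact ⟨‖x‖ * ‖y‖, 1, fun _ => x, fun _ => y, by simp; rfl, by simp⟩
  · rintro z w ⟨r, hr⟩ ⟨s, hs⟩
    exact ⟨r + s, costs_add hr hs⟩

theorem norm_zero_aux : ‖(0 : Alg X Y)‖ = 0 :=
  le_antisymm (csInf_le (bddBelow_costs _) ⟨0, Fin.elim0, Fin.elim0, by simp, by simp⟩)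
    (le_csInf (costs_nonempty _) fun _ hr => costs_nonneg hr)

theorem norm_add_le_aux (z w : Alg X Y) : ‖z + w‖ ≤ ‖z‖ + ‖w‖ := by
  refine le_of_forall_pos_lt_add fun ε hε => ?_
  obtain ⟨r, hr, hr'⟩ := Real.lt_sInf_add_pos (costs_nonempty z) (half_pos hε)
  obtain ⟨s, hs, hs'⟩ := Real.lt_sInf_add_pos (costs_nonempty w) (half_pos hε)
  have := csInf_le (bddBelow_costs _) (costs_add hr hs)
  simp only [norm_def]
  linarith

theorem norm_smul_le_aux (a : ℝ) (z : Alg X Y) : ‖a • z‖ ≤ ‖a‖ * ‖z‖ := by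
  rw [norm_def z, ← smul_eq_mul, ← Real.sInf_smul_of_nonneg (norm_nonneg a)]
  refine le_csInf (costs_nonempty z).smul_set ?_
  rintro _ ⟨r, hr, rfl⟩
  exact csInf_le (bddBelow_costs _) (costs_smul a hr)

/-- The projective norm as a seminorm (by the Hahn-Banach theorem it is a norm). -/
noncomputable def projSeminorm : Seminorm ℝ (Alg X Y) :=
  .ofSMulLE norm norm_zero_aux norm_add_le_aux norm_smul_le_aux

noncomputable instance : SeminormedAddCommGroup (Alg X Y) :=
  { AddGroupSeminorm.toSeminormedAddCommGroup
      (projSeminorm (X := X) (Y := Y)).toAddGroupSeminorm with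
    norm := norm }

noncomputable instance : NormedSpace ℝ (Alg X Y) := ⟨norm_smul_le_aux⟩

end

end ProjTensor

/-- The projective tensor product of `X` and `Y`: the completion of the algebraic tensor product
for the projective norm. -/
abbrev ProjectiveTensorProduct (X Y : Type*) [NormedAddCommGroup X] [NormedSpace ℝ X]
    [NormedAddCommGroup Y] [NormedSpace ℝ Y] : Type _ :=
  UniformSpace.Completion (ProjTensor.Alg X Y)

/-- The metric approximation property: there is a net of finite-rank operators of norm at most one
that converges pointwise to the identity. -/
def HasMAP.{u} (X : Type u) [NormedAddCommGroup X] [NormedSpace ℝ X] : Prop :=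
  ∃ (A : Type u) (_ : Preorder A) (_ : IsDirectedOrder A) (_ : Nonempty A) (S : A → X →L[ℝ] X),
    (∀ α, FiniteDimensional ℝ (LinearMap.range (S α).toLinearMap)) ∧
    (∀ α, ‖S α‖ ≤ 1) ∧
    ∀ x, Filter.Tendsto (fun α => S α x) Filter.atTop (𝓝 x)

/-- The norm of `Z` is strongly subdifferentiable: for every `x` in the unit sphere, the one-sided
limit of `(‖x + t • h‖ - ‖x‖) / t` as `t → 0⁺` exists uniformly for `h` in the unit sphere. -/
def IsSSD (Z : Type*) [NormedAddCommGroup Z] [NormedSpace ℝ Z] : Prop :=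
  ∀ x ∈ Metric.sphere (0 : Z) 1, ∃ φ : Z → ℝ,
    TendstoUniformlyOn (fun (t : ℝ) (h : Z) => (‖x + t • h‖ - ‖x‖) / t) φ (𝓝[>] 0)
      (Metric.sphere (0 : Z) 1)

/-! A contraction `T : Y → X` acts on the tensor product as the contractive functional `y ⊗ φ ↦ φ (T
y)` (`exists_pairing`). The MAP yields unit vectors `y n` and finite-rank contractions `T k` with `T
k (y n) → y n` as `k → ∞`, yet `T k (y n) = 0` for `n > k` (`HasMAP.exists_seq`). Let `φ n` norm `y
n`, and put `e n = y n ⊗ φ n` and `z = ∑ 2⁻ⁿ⁻¹ e n`. The inclusion `Y → X` norms every `e n`, hence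
`z`, and the norm at `z` has slope at most `-1` in each direction `-e n`. SSD would give a single `t
> 0` with `‖z - t e n‖ ≤ 1 - t / 2` for all `n`. Testing against the functional of `T k`, blind to
`e (k + 1)`, bounds its value at `z` by `1 - t / 2`, although these values tend to `1`
(`not_isSSD_of_seq`). -/

namespace ProjTensor

/-! ### Operators as functionals on the projective tensor product -/

section Pairing

variable {X Y : Type*} [NormedAddCommGroup X] [NormedSpace ℝ X]
  [NormedAddCommGroup Y] [NormedSpace ℝ Y]

theorem norm_tmul_le (x : X) (y : Y) : ‖tmul x y‖ ≤ ‖x‖ * ‖y‖ :=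
  csInf_le (bddBelow_costs _) ⟨1, fun _ => x, fun _ => y, by simp, by simp⟩

/-- The linear form `y ⊗ φ ↦ φ (T y)` on the algebraic tensor product. -/
noncomputable def algPairing (T : Y →L[ℝ] X) : Alg Y (StrongDual ℝ X) →ₗ[ℝ] ℝ :=
  TensorProduct.lift (LinearMap.mk₂ ℝ (fun (y : Y) (φ : StrongDual ℝ X) => φ (T y))
    (by intros; simp) (by intros; simp) (by intros; simp) (by intros; simp))

theorem algPairing_tmul (T : Y →L[ℝ] X) (y : Y) (φ : StrongDual ℝ X) :
    algPairing T (tmul y φ) = φ (T y) := by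
  unfold algPairing tmul
  exact TensorProduct.lift.tmul y φ

theorem norm_algPairing_le (T : Y →L[ℝ] X) (u : Alg Y (StrongDual ℝ X)) :
    ‖algPairing T u‖ ≤ ‖T‖ * ‖u‖ := by
  rw [norm_def u, ← smul_eq_mul, ← Real.sInf_smul_of_nonneg (norm_nonneg T)]
  refine le_csInf (costs_nonempty u).smul_set ?_
  rintro _ ⟨_, ⟨n, y, φ, rfl, rfl⟩, rfl⟩
  rw [map_sum]
  refine (norm_sum_le _ _).trans ?_
  simp only [smul_eq_mul, Finset.mul_sum, algPairing_tmul]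
  refine Finset.sum_le_sum fun i _ => ((φ i).le_opNorm _).trans ?_
  calc ‖φ i‖ * ‖T (y i)‖ ≤ ‖φ i‖ * (‖T‖ * ‖y i‖) := by gcongr; exact T.le_opNorm _
    _ = ‖T‖ * (‖y i‖ * ‖φ i‖) := by ring

/-- An operator of norm at most one acts as a contractive functional on the projective tensor
product. -/
theorem exists_pairing (T : Y →L[ℝ] X) (hT : ‖T‖ ≤ 1) :
    ∃ Φ : StrongDual ℝ (ProjectiveTensorProduct Y (StrongDual ℝ X)),
      (∀ y φ, Φ (tmul y φ : Alg Y (StrongDual ℝ X)) = φ (T y)) ∧ ∀ z, Φ z ≤ ‖z‖ := by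
  let f : Alg Y (StrongDual ℝ X) →L[ℝ] ℝ :=
    (algPairing T).mkContinuous ‖T‖ (norm_algPairing_le T)
  let Φ := f.extend (UniformSpace.Completion.toComplL (𝕜 := ℝ) (E := Alg Y (StrongDual ℝ X)))
  have hΦ (u : Alg Y (StrongDual ℝ X)) : Φ u = algPairing T u :=
    f.extend_eq UniformSpace.Completion.denseRange_coe
      (UniformSpace.Completion.isUniformInducing_coe _) u
  refine ⟨Φ, fun y φ => by rw [hΦ, algPairing_tmul], fun z => ?_⟩
  induction z using UniformSpace.Completion.induction_on with
  | hp => exact isClosed_le Φ.continuous continuous_norm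
  | ih u =>
    rw [hΦ, UniformSpace.Completion.norm_coe]
    exact (le_abs_self _).trans ((norm_algPairing_le T u).trans
      (mul_le_of_le_one_left (norm_nonneg _) hT))

end Pairing

end ProjTensor

/-! ### Gliding-hump sequences from the MAP -/

section Sequences

variable {X Y : Type*} [NormedAddCommGroup X] [NormedSpace ℝ X]
  [NormedAddCommGroup Y] [NormedSpace ℝ Y]

/-- Finitely many finite-rank operators on an infinite-dimensional space have a common zero of
norm one. -/
theorem exists_norm_eq_one_forall_apply_eq_zero (hY : ¬ FiniteDimensional ℝ Y) {ι : Type*}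
    [Finite ι] (T : ι → Y →L[ℝ] X)
    (hT : ∀ i, FiniteDimensional ℝ (LinearMap.range (T i).toLinearMap)) :
    ∃ y : Y, ‖y‖ = 1 ∧ ∀ i, T i y = 0 := by
  let L := LinearMap.pi fun i => (T i).toLinearMap.rangeRestrict
  have hL : ¬ Function.Injective L := fun h => hY (FiniteDimensional.of_injective L h)
  rw [← LinearMap.ker_eq_bot, Submodule.eq_bot_iff] at hL
  push Not at hL
  obtain ⟨y, hy, hy0⟩ := hL
  refine ⟨(‖y‖⁻¹ : ℝ) • y, norm_smul_inv_norm (𝕜 := ℝ) hy0, fun i => ?_⟩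
  have h : T i y = 0 := congrArg Subtype.val (congrFun (LinearMap.mem_ker.1 hy) i)
  rw [map_smul, h, smul_zero]

/-- In a space with the metric approximation property, every infinite-dimensional subspace contains
a sequence of unit vectors on which suitable finite-rank contractions converge pointwise, each of
them vanishing on a tail of the sequence. -/
theorem HasMAP.exists_seq (hMAP : HasMAP X) (hY : ¬ FiniteDimensional ℝ Y) (j : Y →ₗᵢ[ℝ] X) :
    ∃ (y : ℕ → Y) (T : ℕ → Y →L[ℝ] X), (∀ n, ‖y n‖ = 1) ∧ (∀ k, ‖T k‖ ≤ 1) ∧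
      (∀ k n, k < n → T k (y n) = 0) ∧
      ∀ n, Filter.Tendsto (fun k => T k (y n)) Filter.atTop (𝓝 (j (y n))) := by
  obtain ⟨A, _, _, _, S, hfin, hnorm, hlim⟩ := hMAP
  -- A triple holds a vector, an index of the net and a precision counter. Each new vector is killed
  -- by all earlier operators; each new operator almost fixes all earlier vectors.
  let P (p : Y × A × ℕ) : Prop := ‖p.1‖ = 1
  let r (p q : Y × A × ℕ) : Prop :=
    p.2.2 < q.2.2 ∧ S p.2.1 (j q.1) = 0 ∧ dist (S q.2.1 (j p.1)) (j p.1) < 1 / (q.2.2 + 1 : ℝ)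
  obtain ⟨f, hP, hr⟩ := exists_seq_of_forall_finset_exists P r (fun s _ => by
    obtain ⟨y, hy, hy0⟩ := exists_norm_eq_one_forall_apply_eq_zero hY
      (fun p : s => (S p.1.2.1).comp j.toContinuousLinearMap) (fun p => by
        have := hfin p.1.2.1
        exact Submodule.finiteDimensional_of_le
          (LinearMap.range_comp_le_range j.toLinearMap (S p.1.2.1).toLinearMap))
    obtain ⟨m, hm⟩ : ∃ m : ℕ, ∀ p ∈ s, p.2.2 < m :=
      ⟨s.sup (fun p => p.2.2) + 1, fun p hp =>
        Nat.lt_succ_of_le (Finset.le_sup (f := fun p : Y × A × ℕ => p.2.2) hp)⟩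
    have hev : ∀ᶠ α in Filter.atTop, ∀ p ∈ s, dist (S α (j p.1)) (j p.1) < 1 / (m + 1 : ℝ) :=
      (Filter.eventually_all_finset s).2 fun p _ =>
        (hlim (j p.1)).eventually (Metric.ball_mem_nhds _ Nat.one_div_pos_of_nat)
    obtain ⟨α, hα⟩ := hev.exists
    exact ⟨(y, α, m), hy, fun p hp => ⟨hm p hp, hy0 ⟨p, hp⟩, hα p hp⟩⟩)
  refine ⟨fun n => (f n).1, fun k => (S (f k).2.1).comp j.toContinuousLinearMap, hP, fun k => ?_,
    fun k n hkn => (hr k n hkn).2.1, fun n => ?_⟩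
  · exact ContinuousLinearMap.opNorm_le_bound _ zero_le_one fun y =>
      ((S _).le_of_opNorm_le (hnorm _) _).trans_eq (by simp)
  -- The counter increases strictly, so at stage `k` it is at least `k` and the error is below `1 /
  -- (k + 1)`.
  · have hmono : StrictMono fun k => (f k).2.2 := strictMono_nat_of_lt_succ fun k =>
      (hr k (k + 1) k.lt_succ_self).1
    refine tendsto_iff_dist_tendsto_zero.2 (squeeze_zero' (.of_forall fun _ => dist_nonneg) ?_
      tendsto_one_div_add_atTop_nhds_zero_nat)
    filter_upwards [Filter.eventually_gt_atTop n] with k hk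
    refine (hr n k hk).2.2.le.trans ?_
    gcongr
    exact hmono.id_le k

end Sequences

/-! ### Failure of uniformity in the subdifferential limit -/

section Geometry

variable {Z : Type*} [NormedAddCommGroup Z] [NormedSpace ℝ Z]

/-- A norm is not strongly subdifferentiable as soon as there are unit vectors `e n`, all normed by
one contractive functional, which is approached on each of them by contractive functionals that
vanish on a tail of the sequence. -/
theorem not_isSSD_of_seq [CompleteSpace Z] (e : ℕ → Z) (he : ∀ n, ‖e n‖ = 1)
    (Φ : StrongDual ℝ Z) (hΦ : ∀ z, Φ z ≤ ‖z‖) (hΦe : ∀ n, Φ (e n) = 1)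
    (w : ℕ → StrongDual ℝ Z) (hw : ∀ k z, w k z ≤ ‖z‖) (hw0 : ∀ k n, k < n → w k (e n) = 0)
    (hlim : ∀ n, Filter.Tendsto (fun k => w k (e n)) Filter.atTop (𝓝 1)) : ¬ IsSSD Z := by
  intro hSSD
  let c (n : ℕ) : ℝ := 1 / 2 / 2 ^ n
  have hc : HasSum c 1 := hasSum_geometric_two' 1
  have hcpos (n : ℕ) : 0 < c n := by positivity
  have hnorm (n : ℕ) : ‖c n • e n‖ = c n := by
    rw [norm_smul, he, mul_one, Real.norm_of_nonneg (hcpos n).le]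
  have hsum : Summable fun n => c n • e n := .of_norm (by simpa only [hnorm] using hc.summable)
  obtain ⟨z, hz⟩ := hsum
  have hΦz : Φ z = 1 := by
    have := hz.mapL Φ
    simp only [map_smul, hΦe, smul_eq_mul, mul_one] at this
    exact this.unique hc
  -- Subtracting `t • e n` only changes the `n`-th coefficient to `c n - t ≥ 0`, and the
  -- coefficients then sum to `1 - t`.
  have hzle (n : ℕ) (t : ℝ) (ht : t ≤ c n) : ‖z - t • e n‖ ≤ 1 - t := by
    have h1 : ‖z - c n • e n‖ ≤ 1 - c n := by
      have hz' := hz.update n 0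
      have hc' := hc.update n 0
      rw [zero_sub, neg_add_eq_sub] at hz' hc'
      refine hz'.norm_le_of_bounded hc' fun i => ?_
      by_cases hi : i = n
      · subst hi; simp
      · simp [Function.update_of_ne hi, hnorm]
    calc ‖z - t • e n‖ = ‖(z - c n • e n) + (c n - t) • e n‖ := by congr 1; module
      _ ≤ (1 - c n) + (c n - t) := by
        refine (norm_add_le _ _).trans (add_le_add h1 ?_)
        rw [norm_smul, he, mul_one, Real.norm_of_nonneg (sub_nonneg.2 ht)]
      _ = 1 - t := by ring
  have hz1 : ‖z‖ = 1 := by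
    refine le_antisymm ?_ (hΦz ▸ hΦ z)
    simpa using hzle 0 0 (hcpos 0).le
  have hwz : Filter.Tendsto (fun k => w k z) Filter.atTop (𝓝 1) := by
    have h : Filter.Tendsto (fun k => ∑' n, c n * w k (e n)) Filter.atTop (𝓝 (∑' n, c n * 1)) := by
      refine tendsto_tsum_of_dominated_convergence hc.summable
        (fun n => (hlim n).const_mul (c n)) (.of_forall fun k n => ?_)
      rw [norm_mul, Real.norm_of_nonneg (hcpos n).le]
      refine mul_le_of_le_one_right (hcpos n).le (abs_le.2 ⟨?_, (hw k _).trans_eq (he n)⟩)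
      have := hw k (-e n)
      rw [map_neg, norm_neg, he] at this
      linarith
    simp only [mul_one, hc.tsum_eq] at h
    refine h.congr fun k => ?_
    simpa using (hz.mapL (w k)).tsum_eq
  obtain ⟨φ, hφ⟩ := hSSD z (by simpa using hz1)
  have hmem (n : ℕ) : -e n ∈ Metric.sphere (0 : Z) 1 := by simp [he]
  have hφe (n : ℕ) : φ (-e n) ≤ -1 := by
    refine le_of_tendsto (hφ.tendsto_at (hmem n)) ?_
    filter_upwards [Ioo_mem_nhdsGT (hcpos n)] with t ht
    rw [div_le_iff₀ ht.1, smul_neg, ← sub_eq_add_neg, hz1]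
    linarith [hzle n t ht.2.le]
  -- With tolerance `1 / 2`, slopes at most `-1` in the limit stay below `-1 / 2` at one `t` common
  -- to all `n`.
  obtain ⟨t, ht, ht0⟩ := ((Metric.tendstoUniformlyOn_iff.1 hφ (1 / 2) (by norm_num)).and
    self_mem_nhdsWithin).exists
  have ht0 : 0 < t := ht0
  have hbound (n : ℕ) : ‖z - t • e n‖ ≤ 1 - t / 2 := by
    have h := (abs_lt.1 (ht (-e n) (hmem n))).1
    have h' : (‖z + t • -e n‖ - ‖z‖) / t ≤ -(1 / 2) := by linarith [hφe n]
    rw [div_le_iff₀ ht0, smul_neg, ← sub_eq_add_neg, hz1] at h'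
    linarith
  -- Since `w k` vanishes at `e (k + 1)`, it takes the same value at `z` and at `z - t • e (k + 1)`.
  have hle : (1 : ℝ) ≤ 1 - t / 2 := le_of_tendsto hwz (.of_forall fun k => by
    have := (hw k (z - t • e (k + 1))).trans (hbound (k + 1))
    simpa [hw0 k (k + 1) k.lt_succ_self] using this)
  linarith

end Geometry

/-! ### The main result -/

open ProjTensor in
/-- The result for a space that embeds isometrically into a space with the metric approximation
property. -/
theorem HasMAP.not_isSSD_projectiveTensorProduct {X Y : Type*} [NormedAddCommGroup X]
    [NormedSpace ℝ X] [NormedAddCommGroup Y] [NormedSpace ℝ Y] (hMAP : HasMAP X)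
    (hY : ¬ FiniteDimensional ℝ Y) (j : Y →ₗᵢ[ℝ] X) :
    ¬ IsSSD (ProjectiveTensorProduct Y (StrongDual ℝ X)) := by
  obtain ⟨y, T, hy, hT, hT0, hlim⟩ := hMAP.exists_seq hY j
  have hdual (n : ℕ) : ∃ φ : StrongDual ℝ X, ‖φ‖ = 1 ∧ φ (j (y n)) = 1 := by
    have h1 : ‖j (y n)‖ = 1 := by rw [j.norm_map, hy]
    obtain ⟨φ, hφ, hφy⟩ := exists_dual_vector ℝ (j (y n)) (norm_ne_zero_iff.1 (by simp [h1]))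
    exact ⟨φ, hφ, by simpa [h1] using hφy⟩
  choose φ hφ hφy using hdual
  obtain ⟨Φ, hΦ, hΦle⟩ := exists_pairing j.toContinuousLinearMap j.norm_toContinuousLinearMap_le
  choose w hw hwle using fun k => exists_pairing (T k) (hT k)
  have hΦe (n : ℕ) : Φ (tmul (y n) (φ n) : Alg Y (StrongDual ℝ X)) = 1 := by
    rw [hΦ]; exact hφy n
  refine not_isSSD_of_seq (fun n => ((tmul (y n) (φ n) : Alg Y (StrongDual ℝ X)) :
    ProjectiveTensorProduct Y (StrongDual ℝ X))) (fun n => le_antisymm ?_ ?_) Φ hΦle hΦe w hwle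
    (fun k n hkn => ?_) (fun n => ?_)
  · rw [UniformSpace.Completion.norm_coe]
    exact (norm_tmul_le _ _).trans_eq (by simp [hy, hφ])
  · exact (hΦe n).symm.le.trans (hΦle _)
  · rw [hw, hT0 k n hkn, map_zero]
  · simp only [hw]
    rw [← hφy n]
    exact ((φ n).continuous.tendsto _).comp (hlim n)

theorem corollary2p2 {X : Type*} [NormedAddCommGroup X] [NormedSpace ℝ X] [CompleteSpace X]
    (hX : ¬ FiniteDimensional ℝ X) (hMAP : HasMAP X) :
    (∀ Y : Submodule ℝ X, ¬ FiniteDimensional ℝ Y →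
      ¬ IsSSD (ProjectiveTensorProduct Y (StrongDual ℝ X))) ∧
    ¬ IsSSD (ProjectiveTensorProduct X (StrongDual ℝ X)) :=
  ⟨fun Y hY => hMAP.not_isSSD_projectiveTensorProduct hY Y.subtypeₗᵢ,
    hMAP.not_isSSD_projectiveTensorProduct hX LinearIsometry.id⟩
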